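/- Let $k$ be a field of characteristic $p>0$ and let $$A=k[X,Y,Z,T]/(X^mY+Z^{p^e}+T+T^{sp}),$$ where $m,e,s$ are positive integers such that $p^e\nmid sp$, $sp\nmid p^e$ and $m>1$. Let $x,y,z,t$ denote the images of $X,Y,Z,T$ in $A$. An exponential map on $A$ is a $k$-algebra homomorphism $\phi:A\to A[U]$ such that (i) the composite of $\phi$ with the evaluation $A[U]\to A$ at $U=0$ is the identity of $A$, and (ii) $\phi_V\phi_U=\phi_{V+U}$ as maps $A\to A[V,U]$. Here $\phi_W:A\to A[W]$ denotes $\phi$ with the variable named $W$, and $\phi_V$ is extended to a homomorphism $A[U]\to A[V,U]$ by $\phi_V(U)=U$. Its ring of invariants is $A^\phi=\{a\in A:\phi(a)=a\}$, and $\phi$ is non-trivial if $A^\phi\neq A$. The Derksen invariant $\mathrm{DK}(A)$ is the subring of $A$ generated by the rings $A^\phi$, where $\phi$ runs over all non-trivial exponential maps on $A$. Then $A^\phi\subseteq k[x,z,t]$ for every non-trivial exponential map $\phi$ on $A$. In particular, $\mathrm{DK}(A)\subsetneqq A$. -/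

import Mathlib

namespace GaAction

section Exponential

variable {k A : Type*} [CommRing k] [CommRing A] [Algebra k A]

/-- A `k`-algebra homomorphism `φ : A → A[U]` is an exponential map if
(i) composing `φ` with evaluation at `U = 0` gives the identity of `A`, and
(ii) `φ_V φ_U = φ_{V+U}` as maps `A → A[V, U]`.
Here `A[V, U]` is modelled as `(A[V])[U]`: the inner variable is `V` and the outer one is `U`.
The extension of `φ_V` to `A[U] → A[V, U]` with `U ↦ U` applies `φ_V` to the coefficients, and
`φ_{V+U}` is `φ` followed by the substitution of `V + U` for the variable. -/
structure IsExponentialMap (φ : A →ₐ[k] Polynomial A) : Prop where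
  eval_zero : ∀ a : A, (φ a).eval 0 = a
  comp_eq_add : ∀ a : A,
    (φ a).map (φ : A →+* Polynomial A) =
      (φ a).eval₂ ((Polynomial.C : Polynomial A →+* Polynomial (Polynomial A)).comp
          (Polynomial.C : A →+* Polynomial A))
        (Polynomial.C Polynomial.X + Polynomial.X)

/-- The ring of invariants `A^φ = {a ∈ A | φ(a) = a}`. -/
noncomputable def invariants (φ : A →ₐ[k] Polynomial A) : Subalgebra k A :=
  AlgHom.equalizer φ (Polynomial.CAlgHom : A →ₐ[k] Polynomial A)

theorem mem_invariants (φ : A →ₐ[k] Polynomial A) (a : A) :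
    a ∈ invariants φ ↔ φ a = Polynomial.C a := Iff.rfl

/-- `φ` is a non-trivial exponential map: an exponential map with `A^φ ≠ A`. -/
def IsNontrivialExponentialMap (φ : A →ₐ[k] Polynomial A) : Prop :=
  IsExponentialMap φ ∧ invariants φ ≠ ⊤

end Exponential

/-- The Derksen invariant of the `k`-algebra `A`: the subring of `A` generated by the rings of
invariants of all non-trivial exponential maps on `A`. -/
def derksenInvariant (k A : Type*) [CommRing k] [CommRing A] [Algebra k A] : Subring A :=
  Subring.closure {a : A | ∃ φ : A →ₐ[k] Polynomial A,
    IsNontrivialExponentialMap φ ∧ a ∈ invariants φ}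

end GaAction

namespace Asanuma

/-- The polynomial `X^m Y + Z^(p^e) + T + T^(s p)` in `k[X, Y, Z, T]`; the variables
`X, Y, Z, T` have the indices `0, 1, 2, 3`. -/
noncomputable def relation (k : Type*) [CommRing k] (p m e s : ℕ) : MvPolynomial (Fin 4) k :=
  MvPolynomial.X 0 ^ m * MvPolynomial.X 1 + MvPolynomial.X 2 ^ (p ^ e) + MvPolynomial.X 3
    + MvPolynomial.X 3 ^ (s * p)

/-- The `k`-algebra `k[X, Y, Z, T] / (X^m Y + Z^(p^e) + T + T^(s p))`. -/
abbrev CoordRing (k : Type*) [CommRing k] (p m e s : ℕ) : Type _ :=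
  MvPolynomial (Fin 4) k ⧸ Ideal.span {relation k p m e s}

/-- The image in the quotient of the variable with index `i`: these are `x, y, z, t` for
`i = 0, 1, 2, 3`. -/
noncomputable def gen (k : Type*) [CommRing k] (p m e s : ℕ) (i : Fin 4) : CoordRing k p m e s :=
  Ideal.Quotient.mk (Ideal.span {relation k p m e s}) (MvPolynomial.X i)

end Asanuma

/-!
Let `A` be the coordinate ring. It embeds into `A[x⁻¹] = k[z, t][x, x⁻¹]` (`toHahn_injective`), and
it is graded by giving `x, y, z, t` the weights `1, -m, 0, 0`, the orders in `x`. The subring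
`k[x, z, t]` consists of the components of non-negative weight, and a component of negative weight
is divisible by `y` (`exists_lowest_component`).

Let `φ : A → A[U]` be non-trivial and fix some `a ∉ k[x, z, t]`. Giving `U` the critical rational
weight for which `φ` does not lower weights but is not the identity on terms of lowest weight, the
leading coefficients of `φ x, φ y, φ z, φ t` are polynomials `X, Y, Z, T` in `k[z, t][U]`. They
satisfy the defining relation, have the constant terms `1, -(z^(p^e) + t + t^(sp)), z, t`, and do not
all lie in `k[z, t]`. In `φ a = a` the leading coefficient is a non-zero element of `k[z, t]`, and it
is divisible by `Y`, so `Y` does not involve `U`.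

This is impossible (`natDegree_eq_zero_of_relation`). Write `sp = p^r q` with `1 ≤ r < e`, `q ≥ 2`
and `p ∤ q`, and put `H = Z^(p^(e-r)) + T^q`, so that `X^m Y + T = -H^(p^r)`. Let `D` be `∂/∂t` on
the coefficients of polynomials in `U`. Then `D T = -D (X^m Y)` is divisible by `X^(m-1)`, and it is
not zero, since its constant term is `1`; also `D H = q T^(q-1) D T`. As `D` does not raise degrees
in `U`, these give `(m-1) deg X ≤ deg D T ≤ deg T` and `(q-1) deg T + deg D T ≤ deg H`, whereas
`p^r deg H ≤ max (m deg X) (deg T)`. With `p^r, q, m ≥ 2` all degrees are zero.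

The Derksen invariant is therefore contained in `k[x, z, t]`, and `y` is not in that subring.
-/

namespace Asanuma

open Polynomial

/-! ### Polynomial solutions of the relation -/

/-- The extension of a derivation `d` of `P` to `P[U]` that applies `d` to each coefficient, so that
`U` is a constant. -/
noncomputable def coeffDerivation {P : Type*} [CommRing P] (d : Derivation ℤ P P) :
    Derivation ℤ P[X] P[X] :=
  (PolynomialModule.equivPolynomialSelf (R := P)).toLinearMap.compDer d.mapCoeffs

theorem coeff_coeffDerivation {P : Type*} [CommRing P] (d : Derivation ℤ P P) (u : P[X]) (n : ℕ) :
    (coeffDerivation d u).coeff n = d (u.coeff n) := rfl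

theorem natDegree_coeffDerivation_le {P : Type*} [CommRing P] (d : Derivation ℤ P P) (u : P[X]) :
    (coeffDerivation d u).natDegree ≤ u.natDegree := by
  refine natDegree_le_iff_coeff_eq_zero.2 fun n hn => ?_
  rw [coeff_coeffDerivation, coeff_eq_zero_of_natDegree_lt hn, map_zero]

/-- The two divisibility hypotheses say that `s * p = p ^ r * q` with `1 ≤ r < e`, `2 ≤ q` and
`p ∤ q`. -/
theorem exists_eq_pow_mul_of_not_dvd {p e s : ℕ} (hp : p.Prime) (hs : 0 < s)
    (h₁ : ¬ p ^ e ∣ s * p) (h₂ : ¬ s * p ∣ p ^ e) :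
    ∃ r q, s * p = p ^ r * q ∧ 1 ≤ r ∧ r < e ∧ 2 ≤ q ∧ ¬ p ∣ q := by
  have h0 : s * p ≠ 0 := Nat.mul_ne_zero hs.ne' hp.ne_zero
  obtain ⟨r, q, hq, hrq⟩ := Nat.exists_eq_pow_mul_and_not_dvd h0 p hp.ne_one
  have hre : r < e := by
    by_contra! h
    exact h₁ (hrq ▸ (pow_dvd_pow p h).mul_right q)
  refine ⟨r, q, hrq, ?_, hre, ?_, hq⟩
  · by_contra! h
    obtain rfl : r = 0 := by omega
    exact hq ⟨s, by rw [pow_zero, one_mul] at hrq; rw [← hrq, mul_comm]⟩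
  · by_contra! h
    have : q ≠ 0 := by rintro rfl; simp at hq
    obtain rfl : q = 1 := by omega
    exact h₂ (by rw [hrq, mul_one]; exact pow_dvd_pow p hre.le)

/-- Rigidity of solutions `(x, z, t)` in `P[U]` of `x^m y + z^(p^e) + t + t^(sp) = 0` with `y`
independent of `U`: if some derivation of the coefficients does not kill the constant term of `t`,
then the solution does not involve `U`. -/
theorem natDegree_eq_zero_of_relation {P : Type*} [CommRing P] [IsDomain P] {p : ℕ}
    (hp : p.Prime) [CharP P p] {m e s : ℕ} (hm : 1 < m) (hs : 0 < s)
    (h₁ : ¬ p ^ e ∣ s * p) (h₂ : ¬ s * p ∣ p ^ e) (d : Derivation ℤ P P) (y : P) (x z t : P[X])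
    (hrel : x ^ m * C y + z ^ (p ^ e) + t + t ^ (s * p) = 0) (ht : d (t.coeff 0) ≠ 0) :
    x.natDegree = 0 ∧ z.natDegree = 0 ∧ t.natDegree = 0 := by
  have : Fact p.Prime := ⟨hp⟩
  have hp2 := hp.two_le
  obtain ⟨r, q, hrq, hr, hre, hq2, hpq⟩ := exists_eq_pow_mul_of_not_dvd hp hs h₁ h₂
  set D := coeffDerivation d
  have hDt : D t ≠ 0 := fun h => ht (by rw [← coeff_coeffDerivation, h, coeff_zero])
  have ht0 : t ≠ 0 := by rintro rfl; simp at hDt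
  have hDpow : ∀ (u : P[X]) {n : ℕ}, p ∣ n → D (u ^ n) = 0 := by
    intro u n hn
    have : (n : P[X]) = 0 := (CharP.cast_eq_zero_iff P[X] p n).2 hn
    rw [Derivation.leibniz_pow, nsmul_eq_mul, this, zero_mul]
  -- `h` is the `p ^ r`-th root of `z ^ (p ^ e) + t ^ (s * p)`; as `r < e`, the derivation `D` kills
  -- its first term, so that `D h = q * t ^ (q - 1) * D t`, while `D (h ^ (p ^ r)) = 0`.
  set h := z ^ (p ^ (e - r)) + t ^ q with hh
  have hpow : h ^ (p ^ r) = z ^ (p ^ e) + t ^ (s * p) := by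
    rw [hh, add_pow_char_pow, ← pow_mul, ← pow_mul, ← pow_add, Nat.sub_add_cancel hre.le, hrq,
      mul_comm q]
  have hrel' : x ^ m * C y + t = - h ^ (p ^ r) := by rw [hpow]; linear_combination hrel
  -- `D t = -D (x ^ m * y)`
  have hdvd : x ^ (m - 1) ∣ D t := by
    have h1 := congrArg D hrel'
    rw [map_add, map_neg, hDpow h (dvd_pow_self p (by omega)), neg_zero, Derivation.leibniz,
      Derivation.leibniz_pow] at h1
    have h2 : D t = x ^ (m - 1) * (-(x * D (C y)) - C y * (m * D x)) := by
      have : x ^ m = x ^ (m - 1) * x := by rw [← pow_succ]; congr 1; omega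
      simp only [smul_eq_mul, nsmul_eq_mul] at h1
      rw [this] at h1
      linear_combination h1
    exact ⟨_, h2⟩
  have hDh : D h = q * t ^ (q - 1) * D t := by
    rw [hh, map_add, hDpow z (dvd_pow_self p (by omega)), zero_add, Derivation.leibniz_pow,
      nsmul_eq_mul, smul_eq_mul, mul_assoc]
  have hq0 : (q : P[X]) ≠ 0 := fun h => hpq ((CharP.cast_eq_zero_iff P[X] p q).1 h)
  have e1 : (m - 1) * x.natDegree ≤ (D t).natDegree := by
    rw [← natDegree_pow]; exact natDegree_le_of_dvd hdvd hDt
  have e2 : (D t).natDegree ≤ t.natDegree := natDegree_coeffDerivation_le d t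
  have e3 : (q - 1) * t.natDegree + (D t).natDegree ≤ h.natDegree := by
    have := natDegree_coeffDerivation_le d h
    change (D h).natDegree ≤ _ at this
    rwa [hDh, natDegree_mul (mul_ne_zero hq0 (pow_ne_zero _ ht0)) hDt,
      natDegree_mul hq0 (pow_ne_zero _ ht0), natDegree_natCast, zero_add, natDegree_pow] at this
  have e4 : p ^ r * h.natDegree ≤ max (m * x.natDegree) t.natDegree := by
    rw [← natDegree_pow, ← natDegree_neg, ← hrel']
    refine (natDegree_add_le _ _).trans (max_le_max ?_ le_rfl)
    refine natDegree_mul_le.trans ?_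
    rw [natDegree_C, add_zero, natDegree_pow]
  have e5 : 2 ≤ p ^ r := hp2.trans (Nat.le_self_pow (by omega) p)
  have e6 : 2 * h.natDegree ≤ max (m * x.natDegree) t.natDegree :=
    (Nat.mul_le_mul_right _ e5).trans e4
  have e7 : t.natDegree ≤ (q - 1) * t.natDegree := Nat.le_mul_of_pos_left _ (by omega)
  have e8 : m * x.natDegree ≤ 2 * ((m - 1) * x.natDegree) := by
    rw [← mul_assoc]; exact Nat.mul_le_mul_right _ (by omega)
  have htd : t.natDegree = 0 := by omega
  have hxd : x.natDegree = 0 := by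
    have : (m - 1) * x.natDegree = 0 := by omega
    rcases Nat.mul_eq_zero.1 this with h | h <;> omega
  refine ⟨hxd, ?_, htd⟩
  have hz : z ^ (p ^ e) = -(x ^ m * C y + t + t ^ (s * p)) := by linear_combination hrel
  have hz' : (z ^ (p ^ e)).natDegree = 0 := by
    rw [hz, natDegree_neg]
    obtain ⟨x₀, rfl⟩ := natDegree_eq_zero.1 hxd
    obtain ⟨t₀, rfl⟩ := natDegree_eq_zero.1 htd
    rw [← C_pow, ← C_mul, ← C_pow, ← C_add, ← C_add, natDegree_C]
  rw [natDegree_pow] at hz'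
  exact (Nat.mul_eq_zero.1 hz').resolve_left (pow_ne_zero _ hp.ne_zero)

/-! ### Leading terms in Hahn series -/

/-- Instance search finds the algebra structure that goes through power series; this lemma is the
`HahnSeries.algebraMap_apply` for that structure. -/
theorem algebraMap_hahnSeries_eq_single {k B : Type*} [CommRing k] [CommRing B] [Algebra k B]
    (r : k) : algebraMap k (HahnSeries ℚ B) r = HahnSeries.single 0 (algebraMap k B r) := by
  rw [HahnSeries.algebraMap_apply', PowerSeries.algebraMap_apply, HahnSeries.ofPowerSeries_C,
    HahnSeries.C_apply]

/-- All exponents of the series `u` are at least `a`, and its coefficient at `a` is `c`. The value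
`c = 0` is allowed, so `a` need not be the order of `u`. -/
def LeadsWith {B : Type*} [Zero B] (u : HahnSeries ℚ B) (a : ℚ) (c : B) : Prop :=
  (∀ q < a, u.coeff q = 0) ∧ u.coeff a = c

namespace LeadsWith

variable {B : Type*} [CommRing B] {u v : HahnSeries ℚ B} {a b : ℚ} {c d : B}

theorem single (a : ℚ) (c : B) : LeadsWith (HahnSeries.single a c) a c :=
  ⟨fun _ hq => HahnSeries.coeff_single_of_ne hq.ne, HahnSeries.coeff_single_same a c⟩

theorem zero (a : ℚ) : LeadsWith (0 : HahnSeries ℚ B) a 0 := ⟨fun _ _ => rfl, rfl⟩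

theorem add (hu : LeadsWith u a c) (hv : LeadsWith v a d) : LeadsWith (u + v) a (c + d) :=
  ⟨fun q hq => by rw [HahnSeries.coeff_add, hu.1 q hq, hv.1 q hq, add_zero],
    by rw [HahnSeries.coeff_add, hu.2, hv.2]⟩

theorem of_lt (hu : LeadsWith u b c) (h : a < b) : LeadsWith u a 0 :=
  ⟨fun q hq => hu.1 q (hq.trans h), hu.1 a h⟩

theorem sum {ι : Type*} {s : Finset ι} {u : ι → HahnSeries ℚ B} {c : ι → B}
    (h : ∀ i ∈ s, LeadsWith (u i) a (c i)) : LeadsWith (∑ i ∈ s, u i) a (∑ i ∈ s, c i) := by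
  classical
  induction s using Finset.induction_on with
  | empty => simpa using zero a
  | insert i s hi ih =>
    rw [Finset.sum_insert hi, Finset.sum_insert hi]
    exact (h i (Finset.mem_insert_self i s)).add
      (ih fun j hj => h j (Finset.mem_insert_of_mem hj))

theorem mul (hu : LeadsWith u a c) (hv : LeadsWith v b d) : LeadsWith (u * v) (a + b) (c * d) := by
  classical
  have key : ∀ i j : ℚ, i + j ≤ a + b → (i, j) ≠ (a, b) → u.coeff i * v.coeff j = 0 := by
    intro i j hij hne
    rcases lt_or_ge i a with hi | hi
    · rw [hu.1 i hi, zero_mul]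
    rcases lt_or_ge j b with hj | hj
    · rw [hv.1 j hj, mul_zero]
    exact absurd (Prod.ext (by simp; linarith) (by simp; linarith)) hne
  refine ⟨fun q hq => ?_, ?_⟩
  · rw [HahnSeries.coeff_mul]
    refine Finset.sum_eq_zero fun ij hij => ?_
    have hs := (Finset.mem_antidiagonal.1 hij).2.2
    refine key _ _ (by linarith) ?_
    rintro h
    rw [Prod.ext_iff] at h
    simp only at h
    linarith [h.1, h.2]
  · rw [HahnSeries.coeff_mul, ← hu.2, ← hv.2]
    refine Finset.sum_eq_single (a, b) (fun ij hij hne => ?_) (fun h => ?_)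
    · exact key _ _ (Finset.mem_antidiagonal.1 hij).2.2.le hne
    · by_contra h0
      exact h (Finset.mem_antidiagonal.2
        ⟨left_ne_zero_of_mul h0, right_ne_zero_of_mul h0, rfl⟩)

theorem one : LeadsWith (1 : HahnSeries ℚ B) 0 1 := single 0 1

theorem pow (hu : LeadsWith u a c) (n : ℕ) : LeadsWith (u ^ n) (n • a) (c ^ n) := by
  induction n with
  | zero => simpa using one
  | succ n ih => simpa only [pow_succ, succ_nsmul] using ih.mul hu

theorem prod {ι : Type*} {s : Finset ι} {u : ι → HahnSeries ℚ B} {a : ι → ℚ} {c : ι → B}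
    (h : ∀ i ∈ s, LeadsWith (u i) (a i) (c i)) :
    LeadsWith (∏ i ∈ s, u i) (∑ i ∈ s, a i) (∏ i ∈ s, c i) := by
  classical
  induction s using Finset.induction_on with
  | empty => simpa using one
  | insert i s hi ih =>
    rw [Finset.prod_insert hi, Finset.sum_insert hi, Finset.prod_insert hi]
    exact (h i (Finset.mem_insert_self i s)).mul
      (ih fun j hj => h j (Finset.mem_insert_of_mem hj))

theorem aeval_monomial {k σ : Type*} [CommRing k] [Algebra k B] {w : σ → ℚ}
    {u : σ → HahnSeries ℚ B} {c : σ → B} (h : ∀ i, LeadsWith (u i) (w i) (c i))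
    (s : σ →₀ ℕ) (r : k) :
    LeadsWith (MvPolynomial.aeval u (MvPolynomial.monomial s r)) (Finsupp.weight w s)
      (MvPolynomial.aeval c (MvPolynomial.monomial s r)) := by
  rw [MvPolynomial.aeval_monomial, MvPolynomial.aeval_monomial, algebraMap_hahnSeries_eq_single,
    Finsupp.weight_apply, ← zero_add (Finsupp.sum _ _)]
  exact (single 0 _).mul (prod fun i _ => (h i).pow (s i))

theorem aeval {k σ : Type*} [CommRing k] [Algebra k B] {w : σ → ℚ}
    {u : σ → HahnSeries ℚ B} {c : σ → B} (h : ∀ i, LeadsWith (u i) (w i) (c i))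
    {G : MvPolynomial σ k} {n : ℚ} (hG : MvPolynomial.IsWeightedHomogeneous w G n) :
    LeadsWith (MvPolynomial.aeval u G) n (MvPolynomial.aeval c G) := by
  rw [G.as_sum, map_sum, map_sum]
  refine sum fun s hs => ?_
  have := aeval_monomial h s (G.coeff s)
  rwa [hG (MvPolynomial.mem_support_iff.1 hs)] at this

end LeadsWith

/-- Evaluating a weighted homogeneous polynomial at single-term series gives a single-term series. -/
theorem aeval_single_eq_single {B k σ : Type*} [CommRing B] [CommRing k] [Algebra k B] (w : σ → ℚ)
    (c : σ → B) {G : MvPolynomial σ k} {n : ℚ} (hG : MvPolynomial.IsWeightedHomogeneous w G n) :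
    MvPolynomial.aeval (fun i => HahnSeries.single (w i) (c i)) G =
      HahnSeries.single n (MvPolynomial.aeval c G) := by
  classical
  have hprod : ∀ (t : Finset σ) (a : σ → ℚ) (d : σ → B),
      ∏ i ∈ t, HahnSeries.single (a i) (d i) = HahnSeries.single (∑ i ∈ t, a i) (∏ i ∈ t, d i) := by
    intro t a d
    induction t using Finset.induction_on with
    | empty => simp
    | insert i t hi ih =>
      rw [Finset.prod_insert hi, Finset.sum_insert hi, Finset.prod_insert hi, ih,
        HahnSeries.single_mul_single]
  rw [G.as_sum, map_sum, map_sum]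
  refine Eq.trans ?_ (map_sum (HahnSeries.single.addMonoidHom n) _ _).symm
  change _ = ∑ s ∈ _, HahnSeries.single n _
  refine Finset.sum_congr rfl fun s hs => ?_
  rw [MvPolynomial.aeval_monomial, MvPolynomial.aeval_monomial, algebraMap_hahnSeries_eq_single,
    ← hG (MvPolynomial.mem_support_iff.1 hs), Finsupp.weight_apply,
    Finsupp.prod, Finsupp.prod, Finsupp.sum]
  simp_rw [HahnSeries.single_pow]
  rw [hprod, HahnSeries.single_mul_single, zero_add]

/-- `HahnSeries.map` for an algebra homomorphism, as an algebra homomorphism. -/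
noncomputable def hahnMapAlgHom {k B B' : Type*} [CommRing k] [CommRing B] [CommRing B']
    [Algebra k B] [Algebra k B'] (f : B →ₐ[k] B') : HahnSeries ℚ B →ₐ[k] HahnSeries ℚ B' where
  toFun u := u.map f
  map_one' := by
    ext q
    by_cases h : q = 0 <;> simp [HahnSeries.coeff_one, h]
  map_zero' := by ext; simp
  map_add' u v := by ext; simp
  map_mul' u v := HahnSeries.map_mul (f : B →ₙ+* B')
  commutes' r := by
    ext q
    by_cases h : q = 0 <;>
      simp [algebraMap_hahnSeries_eq_single, h]

theorem coeff_hahnMapAlgHom {k B B' : Type*} [CommRing k] [CommRing B] [CommRing B']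
    [Algebra k B] [Algebra k B'] (f : B →ₐ[k] B') (u : HahnSeries ℚ B) (q : ℚ) :
    (hahnMapAlgHom f u).coeff q = f (u.coeff q) := rfl

/-- For `j : A → B((x^ℚ))`, the homomorphism `A[U] → B[U]((x^ℚ))` that applies `j` to the
coefficients and replaces `U` by `U x^γ`, that is, gives `U` the weight `γ`. -/
noncomputable def weightedEval {k A B : Type*} [CommRing k] [CommRing A] [CommRing B]
    [Algebra k A] [Algebra k B] (j : A →ₐ[k] HahnSeries ℚ B) (γ : ℚ) :
    A[X] →ₐ[k] HahnSeries ℚ B[X] :=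
  eval₂AlgHom ((hahnMapAlgHom CAlgHom).comp j) (HahnSeries.single γ X) fun _ => Commute.all _ _

theorem coeff_weightedEval {k A B : Type*} [CommRing k] [CommRing A] [CommRing B]
    [Algebra k A] [Algebra k B] (j : A →ₐ[k] HahnSeries ℚ B) (γ : ℚ) (Q : A[X]) (q : ℚ) (i : ℕ) :
    ((weightedEval j γ Q).coeff q).coeff i = (j (Q.coeff i)).coeff (q - γ * i) := by
  induction Q using Polynomial.induction_on' with
  | add Q R hQ hR => simp [hQ, hR]
  | monomial n a =>
    have : weightedEval j γ (monomial n a) =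
        hahnMapAlgHom (CAlgHom (R := k)) (j a) * HahnSeries.single (n • γ) (X ^ n) := by
      simp [weightedEval, HahnSeries.single_pow]
    rw [this, HahnSeries.coeff_mul_single, coeff_hahnMapAlgHom, CAlgHom_apply, coeff_C_mul_X_pow,
      coeff_monomial]
    by_cases h : n = i
    · subst h
      simp [mul_comm]
    · simp [h, Ne.symm h]

theorem weightedEval_C {k A B : Type*} [CommRing k] [CommRing A] [CommRing B]
    [Algebra k A] [Algebra k B] (j : A →ₐ[k] HahnSeries ℚ B) (γ : ℚ) (a : A) :
    weightedEval j γ (C a) = hahnMapAlgHom (CAlgHom (R := k)) (j a) := by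
  simp [weightedEval]

/-! ### The coordinate ring and its grading -/

section

variable (k : Type*) [Field k] (p m e s : ℕ)

/-- The polynomial `z^(p^e) + t + t^(sp)` in `k[z][t]`: the inner variable is `z`, the outer one
is `t`. -/
noncomputable def planeCurve : k[X][X] := C X ^ (p ^ e) + X + X ^ (s * p)

/-- The weights `1, -m, 0, 0` of `X, Y, Z, T`, for which the relation is homogeneous of weight `0`.
They are the orders in `x` of the images in `k[z, t][x, x⁻¹]`. -/
def weight : Fin 4 → ℚ := ![1, -m, 0, 0]

/-- The coefficients of the one-term images of `X, Y, Z, T` in `k[z, t][x, x⁻¹]`. -/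
noncomputable def laurentCoeff : Fin 4 → k[X][X] := ![1, -planeCurve k p e s, C X, X]

theorem isWeightedHomogeneous_relation :
    MvPolynomial.IsWeightedHomogeneous (weight m) (relation k p m e s) 0 := by
  have hX := MvPolynomial.isWeightedHomogeneous_X k (weight m)
  have h0 : ∀ n : ℕ, n • (0 : ℚ) = 0 := fun n => smul_zero n
  refine ((MvPolynomial.IsWeightedHomogeneous.add ?_ ?_).add ?_).add ?_
  · have := ((hX 0).pow m).mul (hX 1)
    simpa [weight] using this
  · simpa [weight] using (hX 2).pow (p ^ e)
  · simpa [weight] using hX 3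
  · simpa [weight] using (hX 3).pow (s * p)

theorem aeval_laurentCoeff_relation :
    MvPolynomial.aeval (laurentCoeff k p e s) (relation k p m e s) = 0 := by
  simp only [relation, laurentCoeff, planeCurve, map_add, map_mul, map_pow, MvPolynomial.aeval_X]
  simp
  ring

theorem derivative_planeCurve [CharP k p] :
    derivative (planeCurve k p e s) = 1 := by
  simp [planeCurve, derivative_pow]

/-- The map from the coordinate ring `A` to `A[x⁻¹] = k[z, t][x, x⁻¹]`, composed with the inclusion
into Hahn series in `x` with rational exponents. Rational exponents are needed because `U` is later
given a rational weight. -/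
noncomputable def toHahn : CoordRing k p m e s →ₐ[k] HahnSeries ℚ k[X][X] :=
  Ideal.Quotient.liftₐ _
    (MvPolynomial.aeval fun i => HahnSeries.single (weight m i) (laurentCoeff k p e s i)) (by
      intro a ha
      obtain ⟨b, rfl⟩ := Ideal.mem_span_singleton.1 ha
      rw [map_mul, aeval_single_eq_single _ _ (isWeightedHomogeneous_relation k p m e s),
        aeval_laurentCoeff_relation, map_zero, zero_mul])

theorem toHahn_mk (G : MvPolynomial (Fin 4) k) :
    toHahn k p m e s (Ideal.Quotient.mk _ G) =
      MvPolynomial.aeval (fun i => HahnSeries.single (weight m i) (laurentCoeff k p e s i)) G := rfl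

theorem toHahn_gen (i : Fin 4) :
    toHahn k p m e s (gen k p m e s i) =
      HahnSeries.single (weight m i) (laurentCoeff k p e s i) := by
  rw [gen, toHahn_mk, MvPolynomial.aeval_X]

theorem gen_relation :
    gen k p m e s 0 ^ m * gen k p m e s 1 =
      -(gen k p m e s 2 ^ (p ^ e) + gen k p m e s 3 + gen k p m e s 3 ^ (s * p)) := by
  have h : Ideal.Quotient.mk (Ideal.span {relation k p m e s}) (MvPolynomial.X 0 ^ m *
      MvPolynomial.X 1 + MvPolynomial.X 2 ^ (p ^ e) + MvPolynomial.X 3 +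
        MvPolynomial.X 3 ^ (s * p)) = 0 :=
    Ideal.Quotient.eq_zero_iff_mem.2 (Ideal.mem_span_singleton_self _)
  simp only [map_add, map_mul, map_pow] at h
  simp only [gen]
  linear_combination h

/-- The subalgebra `k[x, z, t]` of the coordinate ring. -/
noncomputable abbrev adjoinXZT : Subalgebra k (CoordRing k p m e s) :=
  Algebra.adjoin k {gen k p m e s 0, gen k p m e s 2, gen k p m e s 3}

theorem gen_mem_adjoinXZT {i : Fin 4} (hi : i ≠ 1) : gen k p m e s i ∈ adjoinXZT k p m e s := by
  refine Algebra.subset_adjoin ?_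
  fin_cases i <;> simp at hi ⊢

theorem gen_pow_mul_gen_mem : gen k p m e s 0 ^ m * gen k p m e s 1 ∈ adjoinXZT k p m e s := by
  rw [gen_relation]
  have h2 := gen_mem_adjoinXZT k p m e s (i := 2) (by decide)
  have h3 := gen_mem_adjoinXZT k p m e s (i := 3) (by decide)
  exact neg_mem (add_mem (add_mem (pow_mem h2 _) h3) (pow_mem h3 _))

theorem exists_pow_mul_mem_adjoinXZT (a : CoordRing k p m e s) :
    ∃ N, gen k p m e s 0 ^ N * a ∈ adjoinXZT k p m e s := by
  have h0 := gen_mem_adjoinXZT k p m e s (i := 0) (by decide)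
  obtain ⟨G, rfl⟩ := Ideal.Quotient.mk_surjective a
  induction G using MvPolynomial.induction_on with
  | C r => exact ⟨0, by
      rw [pow_zero, one_mul]
      exact (adjoinXZT k p m e s).algebraMap_mem r⟩
  | add G H hG hH =>
    obtain ⟨N, hN⟩ := hG
    obtain ⟨M, hM⟩ := hH
    refine ⟨N + M, ?_⟩
    have := add_mem (mul_mem (pow_mem h0 M) hN) (mul_mem (pow_mem h0 N) hM)
    convert this using 1
    rw [map_add]
    ring
  | mul_X G i hG =>
    obtain ⟨N, hN⟩ := hG
    by_cases hi : i = 1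
    · refine ⟨N + m, ?_⟩
      have := mul_mem hN (gen_pow_mul_gen_mem k p m e s)
      convert this using 1
      rw [map_mul, hi, gen, gen]
      ring
    · refine ⟨N, ?_⟩
      have := mul_mem hN (gen_mem_adjoinXZT k p m e s hi)
      convert this using 1
      rw [map_mul, gen, gen]
      ring

/-- `x` is not a zero divisor, because `X` is prime and does not divide the relation. -/
theorem eq_zero_of_gen_zero_mul [CharP k p]
    {a : CoordRing k p m e s} (ha : gen k p m e s 0 * a = 0) : a = 0 := by
  obtain ⟨G, rfl⟩ := Ideal.Quotient.mk_surjective a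
  rw [gen, ← map_mul, Ideal.Quotient.eq_zero_iff_mem, Ideal.mem_span_singleton] at ha
  obtain ⟨Q, hQ⟩ := ha
  have hX : Prime (MvPolynomial.X 0 : MvPolynomial (Fin 4) k) := MvPolynomial.X_prime
  -- Setting `X = Y = 0` sends the relation to `planeCurve`, whose `t`-derivative is `1`.
  have hndvd : ¬ MvPolynomial.X 0 ∣ relation k p m e s := by
    intro h
    have := map_dvd (MvPolynomial.aeval ![0, 0, C X, X] : _ →ₐ[k] k[X][X]) h
    rw [MvPolynomial.aeval_X] at this
    have hf : planeCurve k p e s = 0 := by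
      simpa [relation, planeCurve] using this
    have := derivative_planeCurve k p e s
    rw [hf] at this
    simp at this
  obtain ⟨Q', rfl⟩ := (hX.dvd_or_dvd ⟨G, hQ.symm⟩).resolve_left hndvd
  rw [Ideal.Quotient.eq_zero_iff_mem, Ideal.mem_span_singleton]
  refine ⟨Q', mul_left_cancel₀ hX.ne_zero ?_⟩
  rw [hQ]
  ring

/-- The map `k[z][t][x] → A`, whose range is `k[x, z, t]`. -/
noncomputable def ofPolynomial : k[X][X][X] →ₐ[k] CoordRing k p m e s :=
  eval₂AlgHom (eval₂AlgHom (aeval (gen k p m e s 2)) (gen k p m e s 3) fun _ => Commute.all _ _)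
    (gen k p m e s 0) fun _ => Commute.all _ _

/-- In particular, `toHahn` is injective on `k[x, z, t]`. -/
theorem coeff_toHahn_ofPolynomial (h : k[X][X][X]) (n : ℕ) :
    (toHahn k p m e s (ofPolynomial k p m e s h)).coeff n = h.coeff n := by
  have hP : ∀ b : k[X][X], toHahn k p m e s (ofPolynomial k p m e s (C b)) =
      HahnSeries.single 0 b := by
    intro b
    induction b using Polynomial.induction_on' with
    | add b b' hb hb' => rw [map_add, map_add, map_add, hb, hb', HahnSeries.single_add]
    | monomial i b =>
      have h1 : toHahn k p m e s (aeval (gen k p m e s 2) b) = HahnSeries.single 0 (C b) := by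
        induction b using Polynomial.induction_on' with
        | add b b' hb hb' => rw [map_add, map_add, map_add, hb, hb', HahnSeries.single_add]
        | monomial j r =>
          simp only [aeval_monomial, map_mul, map_pow, AlgHom.commutes, toHahn_gen,
            algebraMap_hahnSeries_eq_single, HahnSeries.single_pow, HahnSeries.single_mul_single]
          simp [weight, laurentCoeff, ← C_mul_X_pow_eq_monomial]
      have h2 : ofPolynomial k p m e s (C (monomial i b)) =
          aeval (gen k p m e s 2) b * gen k p m e s 3 ^ i := by
        simp [ofPolynomial]
      rw [h2, map_mul, map_pow, h1, toHahn_gen, HahnSeries.single_pow,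
        HahnSeries.single_mul_single]
      simp [weight, laurentCoeff, ← C_mul_X_pow_eq_monomial]
  induction h using Polynomial.induction_on' with
  | add h h' hb hb' => simp [hb, hb']
  | monomial i b =>
    rw [← C_mul_X_pow_eq_monomial, map_mul, map_mul, hP, map_pow]
    have : ofPolynomial k p m e s X = gen k p m e s 0 := by simp [ofPolynomial]
    rw [this, map_pow, toHahn_gen, HahnSeries.single_pow, HahnSeries.single_mul_single]
    simp [weight, laurentCoeff, coeff_X_pow, HahnSeries.coeff_single]

theorem adjoinXZT_le_range : adjoinXZT k p m e s ≤ (ofPolynomial k p m e s).range := by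
  refine Algebra.adjoin_le ?_
  rintro _ (rfl | rfl | rfl)
  · exact ⟨X, by simp [ofPolynomial]⟩
  · exact ⟨C (C X), by simp [ofPolynomial]⟩
  · exact ⟨C X, by simp [ofPolynomial]⟩

/-- Every element of the coordinate ring is moved into `k[x, z, t]` by a power of the
non-zero-divisor `x`, and `toHahn` is injective there. -/
theorem toHahn_injective [CharP k p] :
    Function.Injective (toHahn k p m e s) := by
  refine (injective_iff_map_eq_zero _).2 fun a ha => ?_
  obtain ⟨N, hN⟩ := exists_pow_mul_mem_adjoinXZT k p m e s a
  obtain ⟨h, hh⟩ := adjoinXZT_le_range k p m e s hN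
  have h0 : h = 0 := by
    ext1 n
    have := coeff_toHahn_ofPolynomial k p m e s h n
    change ofPolynomial k p m e s h = _ at hh
    rw [hh, map_mul, ha, mul_zero, HahnSeries.coeff_zero] at this
    rw [← this, coeff_zero]
  have hx : gen k p m e s 0 ^ N * a = 0 := by rw [← hh, h0]; exact map_zero _
  clear hN hh
  induction N with
  | zero => simpa using hx
  | succ N ih =>
    refine ih (eq_zero_of_gen_zero_mul k p m e s ?_)
    rw [← hx]
    ring

theorem exists_leadsWith_toHahn_of_mem_adjoinXZT {b : CoordRing k p m e s}
    (hb : b ∈ adjoinXZT k p m e s) : ∃ c, LeadsWith (toHahn k p m e s b) 0 c := by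
  induction hb using Algebra.adjoin_induction with
  | mem x hx =>
    have hgen : ∀ i, LeadsWith (toHahn k p m e s (gen k p m e s i)) (weight m i)
        (laurentCoeff k p e s i) := fun i => by rw [toHahn_gen]; exact LeadsWith.single _ _
    rcases hx with rfl | rfl | rfl
    · exact ⟨_, (hgen 0).of_lt (by simp [weight])⟩
    · exact ⟨_, hgen 2⟩
    · exact ⟨_, hgen 3⟩
  | algebraMap r =>
    rw [AlgHom.commutes, algebraMap_hahnSeries_eq_single]
    exact ⟨_, LeadsWith.single _ _⟩
  | add a b _ _ ha hb =>
    obtain ⟨⟨c, hc⟩, ⟨d, hd⟩⟩ := ha, hb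
    rw [map_add]
    exact ⟨_, hc.add hd⟩
  | mul a b _ _ ha hb =>
    obtain ⟨⟨c, hc⟩, ⟨d, hd⟩⟩ := ha, hb
    rw [map_mul]
    exact ⟨_, by simpa using hc.mul hd⟩

/-- The image of `y` has order `-m < 0`. -/
theorem gen_one_notMem_adjoinXZT [CharP k p] (hm : 0 < m) :
    gen k p m e s 1 ∉ adjoinXZT k p m e s := by
  intro h
  obtain ⟨c, hc⟩ := exists_leadsWith_toHahn_of_mem_adjoinXZT k p m e s h
  have h0 := hc.1 (-m) (by simpa using hm)
  rw [toHahn_gen] at h0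
  have hf : planeCurve k p e s = 0 := by simpa [weight, laurentCoeff] using h0
  have := derivative_planeCurve k p e s
  rw [hf] at this
  simp at this

theorem weight_apply (d : Fin 4 →₀ ℕ) : Finsupp.weight (weight m) d = d 0 - m * d 1 := by
  rw [Finsupp.weight_apply, Finsupp.sum_fintype _ _ (by simp)]
  simp [Fin.sum_univ_four, weight]
  ring

/-- A monomial `X^i Y^j Z^k T^l` of weight `i - m j ≥ 0` is `x^(i - m j) (x^m y)^j z^k t^l`, and
`x^m y ∈ k[x, z, t]`. -/
theorem mk_mem_adjoinXZT {G : MvPolynomial (Fin 4) k} {n : ℚ} (hn : 0 ≤ n)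
    (hG : MvPolynomial.IsWeightedHomogeneous (weight m) G n) :
    Ideal.Quotient.mk (Ideal.span {relation k p m e s}) G ∈ adjoinXZT k p m e s := by
  rw [G.as_sum, map_sum]
  refine sum_mem fun d hd => ?_
  have hw := hG (MvPolynomial.mem_support_iff.1 hd)
  rw [weight_apply] at hw
  have hle : m * d 1 ≤ d 0 := by
    have : ((m * d 1 : ℕ) : ℚ) ≤ d 0 := by push_cast; linarith
    exact_mod_cast this
  have hmon : Ideal.Quotient.mk (Ideal.span {relation k p m e s})
      (MvPolynomial.monomial d (G.coeff d)) = algebraMap k _ (G.coeff d) *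
        (gen k p m e s 0 ^ (d 0 - m * d 1) * (gen k p m e s 0 ^ m * gen k p m e s 1) ^ d 1 *
          gen k p m e s 2 ^ d 2 * gen k p m e s 3 ^ d 3) := by
    rw [MvPolynomial.monomial_eq, map_mul, Finsupp.prod_fintype _ _ (by simp), Fin.prod_univ_four]
    simp only [map_mul, map_pow]
    rw [mul_pow, ← pow_mul, ← mul_assoc (gen k p m e s 0 ^ _), ← pow_add, Nat.sub_add_cancel hle]
    rfl
  rw [hmon]
  have h := fun i hi => gen_mem_adjoinXZT k p m e s (i := i) hi
  exact mul_mem (Subalgebra.algebraMap_mem _ _) (mul_mem (mul_mem (mul_mem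
    (pow_mem (h 0 (by decide)) _) (pow_mem (gen_pow_mul_gen_mem k p m e s) _))
    (pow_mem (h 2 (by decide)) _)) (pow_mem (h 3 (by decide)) _))

/-- An element outside `k[x, z, t]` has a lowest homogeneous component of negative weight, and such
a component is divisible by `y`. -/
theorem exists_lowest_component {a : CoordRing k p m e s} (ha : a ∉ adjoinXZT k p m e s) :
    ∃ (n : ℚ) (H : MvPolynomial (Fin 4) k) (S : Finset ℚ) (g : ℚ → MvPolynomial (Fin 4) k),
      MvPolynomial.IsWeightedHomogeneous (weight m) (MvPolynomial.X 1 * H) n ∧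
      Ideal.Quotient.mk (Ideal.span {relation k p m e s}) (MvPolynomial.X 1 * H) ≠ 0 ∧
      (∀ i ∈ S, n < i ∧ MvPolynomial.IsWeightedHomogeneous (weight m) (g i) i) ∧
      a = Ideal.Quotient.mk _ (MvPolynomial.X 1 * H + ∑ i ∈ S, g i) := by
  classical
  obtain ⟨G, rfl⟩ := Ideal.Quotient.mk_surjective a
  set π := Ideal.Quotient.mk (Ideal.span {relation k p m e s})
  set g : ℚ → MvPolynomial (Fin 4) k :=
    fun n => MvPolynomial.weightedHomogeneousComponent (weight m) n G
  have hg : ∀ n, MvPolynomial.IsWeightedHomogeneous (weight m) (g n) n := fun n =>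
    MvPolynomial.weightedHomogeneousComponent_isWeightedHomogeneous n G
  set T := (MvPolynomial.weightedHomogeneousComponent_finsupp (w := weight m) G).toFinset
  have hG : G = ∑ n ∈ T, g n := by
    conv_lhs => rw [← MvPolynomial.sum_weightedHomogeneousComponent (weight m) G]
    exact finsum_eq_sum _ _
  set S := T.filter fun n => π (g n) ≠ 0
  have hS : π G = ∑ n ∈ S, π (g n) := by
    rw [hG, map_sum, Finset.sum_filter_ne_zero]
  have hneg : ∃ n ∈ S, n < 0 := by
    by_contra! h
    exact ha (hS ▸ sum_mem fun n hn => mk_mem_adjoinXZT k p m e s (h n hn) (hg n))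
  obtain ⟨n₀, hn₀, hn₀'⟩ := hneg
  set N := S.min' ⟨n₀, hn₀⟩
  have hNS : N ∈ S := S.min'_mem _
  have hN : N < 0 := (S.min'_le n₀ hn₀).trans_lt hn₀'
  have hdvd : MvPolynomial.X 1 ∣ g N := by
    rw [(g N).as_sum]
    refine Finset.dvd_sum fun d hd => MvPolynomial.X_dvd_monomial.2 (Or.inr fun h0 => ?_)
    have hw := hg N (MvPolynomial.mem_support_iff.1 hd)
    rw [weight_apply, h0] at hw
    have : (0 : ℚ) ≤ d 0 := Nat.cast_nonneg _
    push_cast at hw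
    linarith
  obtain ⟨H, hH⟩ := hdvd
  refine ⟨N, H, S.erase N, g, hH ▸ hg N, hH ▸ (Finset.mem_filter.1 hNS).2, fun i hi => ⟨?_, hg i⟩,
    ?_⟩
  · exact lt_of_le_of_ne (S.min'_le i (Finset.mem_of_mem_erase hi)) (Finset.ne_of_mem_erase hi).symm
  · rw [hS, ← hH, map_add, map_sum, Finset.add_sum_erase S (fun i => π (g i)) hNS]

end

/-! ### Invariants outside `k[x, z, t]` -/

/-- If a homomorphism `φ : A → A[U]` that is the identity at `U = 0` fixes an element outside
`k[x, z, t]`, then `φ` is the inclusion of the constants. The additivity of exponential maps is not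
needed. -/
theorem eq_C_of_fixes_notMem_adjoinXZT {k : Type*} [Field k] {p : ℕ} [CharP k p] (hp : p.Prime)
    {m e s : ℕ} (hm : 1 < m) (hs : 0 < s) (h₁ : ¬ p ^ e ∣ s * p) (h₂ : ¬ s * p ∣ p ^ e)
    (φ : CoordRing k p m e s →ₐ[k] (CoordRing k p m e s)[X]) (hφ : ∀ a, (φ a).eval 0 = a)
    {a : CoordRing k p m e s} (ha : a ∉ adjoinXZT k p m e s) (hφa : φ a = C a)
    (b : CoordRing k p m e s) : φ b = C b := by
  classical
  by_contra hb
  have hinj := toHahn_injective k p m e s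
  set j := toHahn k p m e s
  have hgen : ∃ i, φ (gen k p m e s i) ≠ C (gen k p m e s i) := by
    by_contra! h
    refine hb (DFunLike.congr_fun (?_ : φ = CAlgHom) b)
    refine Ideal.Quotient.algHom_ext _ (MvPolynomial.algHom_ext fun i => ?_)
    exact h i
  -- `F` indexes the non-zero terms of positive degree in `U` of the images of the generators.
  set F : Finset (Σ _ : Fin 4, ℕ) :=
    Finset.univ.sigma fun i => (φ (gen k p m e s i)).support.erase 0
  have hF : F.Nonempty := by
    obtain ⟨i, hi⟩ := hgen
    have : ∃ n, n ≠ 0 ∧ (φ (gen k p m e s i)).coeff n ≠ 0 := by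
      by_contra! h
      refine hi (Polynomial.ext fun n => ?_)
      rcases eq_or_ne n 0 with rfl | hn
      · rw [coeff_C_zero, coeff_zero_eq_eval_zero, hφ]
      · rw [h n hn, coeff_C_of_ne_zero hn]
    obtain ⟨n, hn, hn'⟩ := this
    exact ⟨⟨i, n⟩, by simp [F, hn, hn']⟩
  -- The weight `γ` of `U` is the least one for which no `φ (gen i)` has terms of weight below
  -- `weight i`; it is attained at the term of degree `n₀` of `φ (gen i₀)`.
  obtain ⟨⟨i₀, n₀⟩, hmem, hmax⟩ := Finset.exists_max_image F
    (fun x => (weight m x.1 - (j ((φ (gen k p m e s x.1)).coeff x.2)).order) / (x.2 : ℚ)) hF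
  set γ : ℚ := (weight m i₀ - (j ((φ (gen k p m e s i₀)).coeff n₀)).order) / (n₀ : ℚ) with hγ
  have hn₀ : n₀ ≠ 0 ∧ (φ (gen k p m e s i₀)).coeff n₀ ≠ 0 := by simpa [F] using hmem
  set Φ := weightedEval j γ
  set c : Fin 4 → k[X][X][X] := fun i => (Φ (φ (gen k p m e s i))).coeff (weight m i)
  have hcoeff : ∀ i n, (c i).coeff n =
      (j ((φ (gen k p m e s i)).coeff n)).coeff (weight m i - γ * n) :=
    fun i n => coeff_weightedEval j γ _ _ _
  have hlead : ∀ i, LeadsWith (Φ (φ (gen k p m e s i))) (weight m i) (c i) := by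
    refine fun i => ⟨fun q hq => Polynomial.ext fun n => ?_, rfl⟩
    rw [coeff_weightedEval, coeff_zero]
    rcases eq_or_ne n 0 with rfl | hn
    · rw [coeff_zero_eq_eval_zero, hφ, toHahn_gen]
      simp [HahnSeries.coeff_single_of_ne hq.ne]
    · by_cases h0 : (φ (gen k p m e s i)).coeff n = 0
      · rw [h0, map_zero, HahnSeries.coeff_zero]
      · have hle := hmax ⟨i, n⟩ (by simp [F, hn, h0])
        have hpos : (0 : ℚ) < n := by exact_mod_cast Nat.pos_of_ne_zero hn
        rw [div_le_iff₀ hpos] at hle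
        exact HahnSeries.coeff_eq_zero_of_lt_order (by simp only at hle; linarith)
  have hΦ : ∀ G : MvPolynomial (Fin 4) k, Φ (φ (Ideal.Quotient.mk _ G)) =
      MvPolynomial.aeval (fun i => Φ (φ (gen k p m e s i))) G := by
    intro G
    exact DFunLike.congr_fun (MvPolynomial.aeval_unique
      ((Φ.comp φ).comp (Ideal.Quotient.mkₐ k (Ideal.span {relation k p m e s})))) G
  have hc0 : ∀ i, (c i).coeff 0 = laurentCoeff k p e s i := by
    intro i
    rw [hcoeff, coeff_zero_eq_eval_zero, hφ, toHahn_gen]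
    simp
  -- The relation has weight `0`, so it passes to the leading coefficients.
  have hrel : c 0 ^ m * c 1 + c 2 ^ (p ^ e) + c 3 + c 3 ^ (s * p) = 0 := by
    have h := (LeadsWith.aeval hlead (isWeightedHomogeneous_relation k p m e s)).2
    rw [← hΦ, Ideal.Quotient.eq_zero_iff_mem.2 (Ideal.mem_span_singleton_self _), map_zero,
      map_zero, HahnSeries.coeff_zero] at h
    simpa [relation] using h.symm
  -- Comparing the terms of lowest weight in `φ a = a` shows that `c 1` divides a non-zero constant.
  have hc1 : (c 1).natDegree = 0 := by
    obtain ⟨n, H, S, g, hH, hH0, hg, rfl⟩ := exists_lowest_component k p m e s ha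
    have e1 : LeadsWith (Φ (φ (Ideal.Quotient.mk _ (MvPolynomial.X 1 * H + ∑ i ∈ S, g i)))) n
        (c 1 * MvPolynomial.aeval c H) := by
      rw [hΦ, map_add, map_sum]
      have := (LeadsWith.aeval hlead hH).add
        (LeadsWith.sum fun i hi => (LeadsWith.aeval hlead (hg i hi).2).of_lt (hg i hi).1)
      simpa using this
    have e2 : LeadsWith (j (Ideal.Quotient.mk _ (MvPolynomial.X 1 * H + ∑ i ∈ S, g i))) n
        (MvPolynomial.aeval (laurentCoeff k p e s) (MvPolynomial.X 1 * H)) := by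
      have hs := fun i => LeadsWith.single (weight m i) (laurentCoeff k p e s i)
      rw [toHahn_mk, map_add, map_sum]
      have := (LeadsWith.aeval hs hH).add
        (LeadsWith.sum fun i hi => (LeadsWith.aeval hs (hg i hi).2).of_lt (hg i hi).1)
      simpa only [Finset.sum_const_zero, add_zero] using this
    have e3 := e1.2
    rw [hφa, weightedEval_C, coeff_hahnMapAlgHom, e2.2, CAlgHom_apply] at e3
    have hne : MvPolynomial.aeval (laurentCoeff k p e s) (MvPolynomial.X 1 * H) ≠ 0 := by
      intro h0
      refine hH0 (hinj ?_)
      rw [map_zero]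
      change toHahn k p m e s _ = 0
      rw [toHahn_mk, aeval_single_eq_single _ _ hH, h0, map_zero]
    have hdvd : c 1 ∣ C (MvPolynomial.aeval (laurentCoeff k p e s) (MvPolynomial.X 1 * H)) :=
      ⟨_, e3⟩
    have := natDegree_le_of_dvd hdvd (C_ne_zero.2 hne)
    rwa [natDegree_C, Nat.le_zero] at this
  obtain ⟨y, hy⟩ := natDegree_eq_zero.1 hc1
  rw [← hy] at hrel
  have ht : derivative' (R := k[X]) ((c 3).coeff 0) ≠ 0 := by
    rw [hc0]
    simp [laurentCoeff]
  -- The derivation is `∂/∂t`, and the constant term of `c 3` is `t`.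
  obtain ⟨hd0, hd2, hd3⟩ := natDegree_eq_zero_of_relation hp hm hs h₁ h₂
    ((derivative' (R := k[X])).restrictScalars ℤ) y (c 0) (c 2) (c 3) hrel ht
  have hdeg : ∀ i, (c i).natDegree = 0 := by
    intro i
    fin_cases i
    exacts [hd0, hc1, hd2, hd3]
  -- By the choice of `γ`, the leading coefficient at `i₀` has degree at least `n₀` in `U`.
  have hext : (c i₀).coeff n₀ ≠ 0 := by
    rw [hcoeff, hγ, div_mul_cancel₀ _ (by exact_mod_cast hn₀.1), sub_sub_cancel]
    rw [Ne, HahnSeries.coeff_order_eq_zero]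
    exact fun h => hn₀.2 (hinj (h.trans (map_zero j).symm))
  exact hext (coeff_eq_zero_of_natDegree_lt (by rw [hdeg]; exact Nat.pos_of_ne_zero hn₀.1))

end Asanuma

theorem proposition3p7 (k : Type*) [Field k] (p : ℕ) [CharP k p] (hp : 0 < p)
    (m e s : ℕ) (hm : 1 < m) (he : 0 < e) (hs : 0 < s)
    (h₁ : ¬ p ^ e ∣ s * p) (h₂ : ¬ s * p ∣ p ^ e) :
    (∀ φ : Asanuma.CoordRing k p m e s →ₐ[k] Polynomial (Asanuma.CoordRing k p m e s),
      GaAction.IsNontrivialExponentialMap φ →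
        GaAction.invariants φ ≤
          Algebra.adjoin k {Asanuma.gen k p m e s 0, Asanuma.gen k p m e s 2,
            Asanuma.gen k p m e s 3}) ∧
    GaAction.derksenInvariant k (Asanuma.CoordRing k p m e s) < ⊤ := by
  have hprime : p.Prime := (CharP.char_is_prime_or_zero k p).resolve_right hp.ne'
  have main : ∀ φ : Asanuma.CoordRing k p m e s →ₐ[k] Polynomial (Asanuma.CoordRing k p m e s),
      GaAction.IsNontrivialExponentialMap φ →
        GaAction.invariants φ ≤ Asanuma.adjoinXZT k p m e s := by
    intro φ hφ a ha
    by_contra hna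
    refine hφ.2 (eq_top_iff.2 fun b _ => ?_)
    exact Asanuma.eq_C_of_fixes_notMem_adjoinXZT hprime hm hs h₁ h₂ φ hφ.1.eval_zero hna ha b
  refine ⟨main, lt_top_iff_ne_top.2 fun htop => ?_⟩
  have hle : GaAction.derksenInvariant k (Asanuma.CoordRing k p m e s) ≤
      (Asanuma.adjoinXZT k p m e s).toSubring := by
    refine Subring.closure_le.2 ?_
    rintro a ⟨φ, hφ, ha⟩
    exact main φ hφ ha
  rw [htop] at hle
  exact Asanuma.gen_one_notMem_adjoinXZT k p m e s (by omega)
    (hle (Subring.mem_top (Asanuma.gen k p m e s 1)))
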